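/- Let $A\ge 1$ be an integer. For $m\in[0,1)$ let $\operatorname{dn}(x;m)$ be the Jacobi elliptic function with parameter $m$, let $K(m)=\int_0^{\pi/2}\frac{d\theta}{\sqrt{1-m\sin^2\theta}}$, and put $q(x)=A\operatorname{dn}(x;m)$, which is real and has period $2K(m)$ in $x$. For $z\in\mathbb C$ let $\Phi(x;z,m)$ be the $2\times 2$ matrix solution of $$\Phi_x=\begin{pmatrix}-iz & q(x)\\ -q(x) & iz\end{pmatrix}\Phi,\qquad \Phi(0;z,m)=\mathbf 1 ,$$ let $M(z;m)=\Phi(2K(m);z,m)$ be the monodromy matrix, $\Delta(z;m)=\tfrac12\operatorname{tr}M(z;m)$ the Floquet discriminant, and $c(z;m)=\tfrac12\big(M_{11}(z;m)-M_{22}(z;m)\big)$. Subscripts $z$ denote derivatives with respect to $z$. Then: 1. For every $m\in[0,1)$ the function $\Delta(\cdot\,;m)$ is entire. One has $\Delta_{zz}(0;0)=0$. For $m\in[0,1)$ the number $\Delta_{zz}(0;m)$ is real, and $m\mapsto(-1)^A\Delta_{zz}(0;m)$ is strictly decreasing on $[0,1)$; in particular $(-1)^A\Delta_{zz}(0;m)<0$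 for $m\in(0,1)$. 2. For every $m\in[0,1)$ one has $c(0;m)=0$ and $c_z(0;m)=-i\,c_0(m)$, where $$c_0(m)=(-1)^A\int_0^\pi\frac{\cos(2Ay)}{\sqrt{1-m\sin^2 y}}\,dy ,$$ and $c_0(m)>0$ for $m\in(0,1)$. 3. For every $m\in(0,1)$ one has $\Delta(0;m)=(-1)^A$, the point $z=0$ is a simple critical point of $\Delta(\cdot\,;m)$ (that is, $\Delta_z(0;m)=0$ and $\Delta_{zz}(0;m)\ne0$), and $|\Delta(z;m)|>1$ for all $z\ne 0$ on the imaginary axis sufficiently close to $0$. -/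

import Mathlib

noncomputable section

namespace ZSDn

/-! ### Jacobi elliptic functions on the real line -/

/-- The integrand `1 / √(1 - m sin² θ)` of the elliptic integral of the first kind
with parameter `m`. -/
def ellipticIntegrand (m θ : ℝ) : ℝ := 1 / Real.sqrt (1 - m * Real.sin θ ^ 2)

/-- The incomplete elliptic integral of the first kind
`F(φ; m) = ∫₀^φ dθ / √(1 - m sin² θ)`. -/
def ellipticF (m φ : ℝ) : ℝ := ∫ θ in (0 : ℝ)..φ, ellipticIntegrand m θ

/-- The complete elliptic integral of the first kind `K(m) = F(π/2; m)`. -/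
def ellipticK (m : ℝ) : ℝ := ellipticF m (Real.pi / 2)

/-- The Jacobi amplitude `am(x; m)`: the inverse of `φ ↦ F(φ; m)`, which is a bijection of
the real line for `0 ≤ m < 1` (see `ellipticF_bijective`). -/
def jacobiAm (x m : ℝ) : ℝ := Function.invFun (ellipticF m) x

/-- The Jacobi elliptic function `dn(x; m) = √(1 - m sin² am(x; m))` for real `x`. -/
def jacobiDn (x m : ℝ) : ℝ := Real.sqrt (1 - m * Real.sin (jacobiAm x m) ^ 2)

theorem one_sub_pos {m : ℝ} (hm : m ∈ Set.Ico (0 : ℝ) 1) (θ : ℝ) :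
    0 < 1 - m * Real.sin θ ^ 2 := by
  nlinarith [hm.1, hm.2, Real.sin_sq_le_one θ, sq_nonneg (Real.sin θ)]

theorem ellipticIntegrand_continuous {m : ℝ} (hm : m ∈ Set.Ico (0 : ℝ) 1) :
    Continuous (ellipticIntegrand m) := by
  unfold ellipticIntegrand
  refine Continuous.div (by fun_prop) (by fun_prop) fun θ => ?_
  exact (Real.sqrt_pos.2 (one_sub_pos hm θ)).ne'

theorem one_le_ellipticIntegrand {m : ℝ} (hm : m ∈ Set.Ico (0 : ℝ) 1) (θ : ℝ) :
    1 ≤ ellipticIntegrand m θ := by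
  unfold ellipticIntegrand
  rw [le_div_iff₀ (Real.sqrt_pos.2 (one_sub_pos hm θ)), one_mul, Real.sqrt_le_one]
  nlinarith [hm.1, sq_nonneg (Real.sin θ)]

theorem ellipticF_hasDerivAt {m : ℝ} (hm : m ∈ Set.Ico (0 : ℝ) 1) (φ : ℝ) :
    HasDerivAt (ellipticF m) (ellipticIntegrand m φ) φ :=
  ((ellipticIntegrand_continuous hm).integral_hasStrictDerivAt 0 φ).hasDerivAt

theorem ellipticF_strictMono {m : ℝ} (hm : m ∈ Set.Ico (0 : ℝ) 1) :
    StrictMono (ellipticF m) := by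
  refine strictMono_of_deriv_pos fun φ => ?_
  rw [(ellipticF_hasDerivAt hm φ).deriv]
  exact lt_of_lt_of_le one_pos (one_le_ellipticIntegrand hm φ)

theorem ellipticF_continuous {m : ℝ} (hm : m ∈ Set.Ico (0 : ℝ) 1) :
    Continuous (ellipticF m) :=
  continuous_iff_continuousAt.2 fun φ => (ellipticF_hasDerivAt hm φ).continuousAt

theorem ellipticF_sub_monotone {m : ℝ} (hm : m ∈ Set.Ico (0 : ℝ) 1) :
    Monotone fun φ => ellipticF m φ - φ := by
  have h : ∀ φ, HasDerivAt (fun φ => ellipticF m φ - φ) (ellipticIntegrand m φ - 1) φ :=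
    fun φ => (ellipticF_hasDerivAt hm φ).sub (hasDerivAt_id φ)
  refine monotone_of_deriv_nonneg (fun φ => (h φ).differentiableAt) fun φ => ?_
  rw [(h φ).deriv]
  linarith [one_le_ellipticIntegrand hm φ]

theorem ellipticF_zero (m : ℝ) : ellipticF m 0 = 0 := by simp [ellipticF]

theorem ellipticF_surjective {m : ℝ} (hm : m ∈ Set.Ico (0 : ℝ) 1) :
    Function.Surjective (ellipticF m) := by
  have h0 := ellipticF_zero m
  refine (ellipticF_continuous hm).surjective ?_ ?_
  · refine Filter.tendsto_atTop_mono' _ ?_ Filter.tendsto_id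
    filter_upwards [Filter.eventually_ge_atTop 0] with φ hφ
    have := ellipticF_sub_monotone hm hφ
    simp only [h0] at this
    simp only [id]
    linarith
  · refine Filter.tendsto_atBot_mono' _ ?_ Filter.tendsto_id
    filter_upwards [Filter.eventually_le_atBot 0] with φ hφ
    have := ellipticF_sub_monotone hm hφ
    simp only [h0] at this
    simp only [id]
    linarith

theorem ellipticF_bijective {m : ℝ} (hm : m ∈ Set.Ico (0 : ℝ) 1) :
    Function.Bijective (ellipticF m) :=
  ⟨(ellipticF_strictMono hm).injective, ellipticF_surjective hm⟩

theorem ellipticF_jacobiAm {m : ℝ} (hm : m ∈ Set.Ico (0 : ℝ) 1) (x : ℝ) :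
    ellipticF m (jacobiAm x m) = x :=
  Function.invFun_eq (ellipticF_surjective hm x)

theorem jacobiAm_continuous {m : ℝ} (hm : m ∈ Set.Ico (0 : ℝ) 1) :
    Continuous fun x => jacobiAm x m := by
  refine Monotone.continuous_of_surjective (fun x y hxy => ?_) fun φ => ⟨ellipticF m φ, ?_⟩
  · rw [← (ellipticF_strictMono hm).le_iff_le, ellipticF_jacobiAm hm, ellipticF_jacobiAm hm]
    exact hxy
  · exact (ellipticF_strictMono hm).injective (ellipticF_jacobiAm hm _)

theorem jacobiDn_continuous {m : ℝ} (hm : m ∈ Set.Ico (0 : ℝ) 1) :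
    Continuous fun x => jacobiDn x m := by
  have := jacobiAm_continuous hm
  unfold jacobiDn
  fun_prop

/-! ### The Dirac (Zakharov-Shabat) eigenvalue problem -/

/-- The coefficient matrix `-i z σ₃ + Q(x)`, with `Q(x)` the matrix with rows `(0, q(x))` and
`(-conj q(x), 0)`. The eigenvalue equation `i σ₃ (φ' - Q φ) = z φ` is
`φ' = (-i z σ₃ + Q) φ`. -/
def zsMatrix (q : ℝ → ℂ) (z : ℂ) (x : ℝ) : Matrix (Fin 2) (Fin 2) ℂ :=
  !![-Complex.I * z, q x; -(starRingEnd ℂ) (q x), Complex.I * z]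

/-- `Φ` is the fundamental matrix solution of the eigenvalue problem on the whole line, normalized
to be the identity matrix at `x = 0` (the derivative is taken entry by entry). -/
def IsFundamentalMatrix (q : ℝ → ℂ) (z : ℂ) (Φ : ℝ → Matrix (Fin 2) (Fin 2) ℂ) : Prop :=
  Φ 0 = 1 ∧ ∀ x i j, HasDerivAt (fun t => Φ t i j) ((zsMatrix q z x * Φ x) i j) x

/-- The normalized fundamental matrix solution `Φ(x; z)`. For continuous `q` it exists and is
unique (see `fundamentalMatrix_spec` and `IsFundamentalMatrix.eq_fundamentalMatrix`). -/
def fundamentalMatrix (q : ℝ → ℂ) (z : ℂ) : ℝ → Matrix (Fin 2) (Fin 2) ℂ :=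
  Classical.epsilon (IsFundamentalMatrix q z)

/-- The terms of the Peano-Baker series of the linear equation `f' = B f`. -/
def picardTerm {E : Type*} [NormedAddCommGroup E] [NormedSpace ℝ E]
    (B : ℝ → E →L[ℝ] E) (x₀ : E) : ℕ → ℝ → E
  | 0 => fun _ => x₀
  | n + 1 => fun t => ∫ s in (0 : ℝ)..t, B s (picardTerm B x₀ n s)

theorem picardTerm_continuous {E : Type*} [NormedAddCommGroup E] [NormedSpace ℝ E]
    [CompleteSpace E] {B : ℝ → E →L[ℝ] E} (hB : Continuous B) (x₀ : E) (n : ℕ) :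
    Continuous (picardTerm B x₀ n) := by
  induction n with
  | zero => exact continuous_const
  | succ n ih =>
    have h : Continuous fun s => B s (picardTerm B x₀ n s) := hB.clm_apply ih
    exact continuous_iff_continuousAt.2 fun t =>
      (h.integral_hasStrictDerivAt 0 t).hasDerivAt.continuousAt

theorem picardTerm_succ_hasDerivAt {E : Type*} [NormedAddCommGroup E] [NormedSpace ℝ E]
    [CompleteSpace E] {B : ℝ → E →L[ℝ] E} (hB : Continuous B) (x₀ : E) (n : ℕ) (t : ℝ) :
    HasDerivAt (picardTerm B x₀ (n + 1)) (B t (picardTerm B x₀ n t)) t := by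
  have h : Continuous fun s => B s (picardTerm B x₀ n s) :=
    hB.clm_apply (picardTerm_continuous hB x₀ n)
  exact (h.integral_hasStrictDerivAt 0 t).hasDerivAt

theorem exists_norm_bound {E : Type*} [NormedAddCommGroup E] [NormedSpace ℝ E]
    {B : ℝ → E →L[ℝ] E} (hB : Continuous B) (T : ℝ) :
    ∃ C : ℝ, 0 ≤ C ∧ ∀ t, |t| ≤ T → ‖B t‖ ≤ C := by
  obtain ⟨C, hC⟩ := (isCompact_Icc (a := -T) (b := T)).exists_bound_of_continuousOn
    hB.continuousOn
  exact ⟨max C 0, le_max_right _ _, fun t ht =>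
    (hC t (abs_le.1 ht)).trans (le_max_left _ _)⟩

theorem norm_picardTerm_le {E : Type*} [NormedAddCommGroup E] [NormedSpace ℝ E]
    [CompleteSpace E] {B : ℝ → E →L[ℝ] E} (x₀ : E) {C T : ℝ}
    (hC0 : 0 ≤ C) (hC : ∀ t, |t| ≤ T → ‖B t‖ ≤ C) (n : ℕ) :
    ∀ t, |t| ≤ T → ‖picardTerm B x₀ n t‖ ≤ ‖x₀‖ * (C * |t|) ^ n / n.factorial := by
  induction n with
  | zero => intro t _; simp [picardTerm]
  | succ n ih =>
    intro t ht
    have key : ∀ s ∈ Set.uIoc 0 t, ‖B s (picardTerm B x₀ n s)‖ ≤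
        (‖x₀‖ * C ^ (n + 1) / n.factorial) * |s - 0| ^ n := by
      intro s hs
      have hst : |s| ≤ |t| := by
        rcases le_total 0 t with h | h
        · rw [Set.uIoc_of_le h] at hs
          rw [abs_of_pos hs.1, abs_of_nonneg h]; exact hs.2
        · rw [Set.uIoc_of_ge h] at hs
          rw [abs_of_nonpos hs.2, abs_of_nonpos h]; linarith [hs.1]
      calc ‖B s (picardTerm B x₀ n s)‖ ≤ ‖B s‖ * ‖picardTerm B x₀ n s‖ :=
            (B s).le_opNorm _
        _ ≤ C * (‖x₀‖ * (C * |s|) ^ n / n.factorial) :=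
            mul_le_mul (hC s (hst.trans ht)) (ih s (hst.trans ht)) (norm_nonneg _) hC0
        _ = _ := by rw [sub_zero, mul_pow, pow_succ]; ring
    have hint : MeasureTheory.IntegrableOn
        (fun s : ℝ => (‖x₀‖ * C ^ (n + 1) / n.factorial) * |s - 0| ^ n) (Set.uIoc 0 t) := by
      have hc : Continuous
          (fun s : ℝ => (‖x₀‖ * C ^ (n + 1) / n.factorial) * |s - 0| ^ n) := by fun_prop
      exact (hc.intervalIntegrable 0 t).def'
    calc ‖picardTerm B x₀ (n + 1) t‖
        ≤ ∫ s in Set.uIoc 0 t, ‖B s (picardTerm B x₀ n s)‖ :=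
          intervalIntegral.norm_integral_le_integral_norm_uIoc
      _ ≤ ∫ s in Set.uIoc 0 t, (‖x₀‖ * C ^ (n + 1) / n.factorial) * |s - 0| ^ n :=
          MeasureTheory.integral_mono_of_nonneg
            (Filter.Eventually.of_forall fun s => norm_nonneg _) hint
            ((MeasureTheory.ae_restrict_iff' measurableSet_uIoc).2
              (Filter.Eventually.of_forall key))
      _ = _ := by
          rw [MeasureTheory.integral_const_mul, integral_pow_abs_sub_uIoc, sub_zero,
            Nat.factorial_succ, mul_pow]
          push_cast
          field_simp

theorem summable_bound (a b : ℝ) :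
    Summable fun n : ℕ => a * b ^ n / (n.factorial : ℝ) := by
  simpa [mul_div_assoc] using (Real.summable_pow_div_factorial b).mul_left a

/-- Global existence for linear equations with continuous coefficients. -/
theorem exists_linear_solution {E : Type*} [NormedAddCommGroup E] [NormedSpace ℝ E]
    [CompleteSpace E] {B : ℝ → E →L[ℝ] E} (hB : Continuous B) (x₀ : E) :
    ∃ f : ℝ → E, f 0 = x₀ ∧ ∀ t, HasDerivAt f (B t (f t)) t := by
  have hsum : ∀ t, Summable fun n => picardTerm B x₀ n t := by
    intro t
    obtain ⟨C, hC0, hC⟩ := exists_norm_bound hB |t|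
    exact Summable.of_norm_bounded (summable_bound ‖x₀‖ (C * |t|)) fun n =>
      norm_picardTerm_le x₀ hC0 hC n t le_rfl
  refine ⟨fun t => x₀ + ∑' n, picardTerm B x₀ (n + 1) t, ?_, fun t => ?_⟩
  · simp [picardTerm]
  · obtain ⟨C, hC0, hC⟩ := exists_norm_bound hB (|t| + 1)
    have h := hasDerivAt_tsum_of_isPreconnected (𝕜 := ℝ)
      (g := fun n => picardTerm B x₀ (n + 1))
      (g' := fun n s => B s (picardTerm B x₀ n s))
      (u := fun n => C * (‖x₀‖ * (C * (|t| + 1)) ^ n / n.factorial))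
      (t := Set.Ioo (-(|t| + 1)) (|t| + 1)) (y₀ := 0) (y := t)
      ((summable_bound ‖x₀‖ (C * (|t| + 1))).mul_left C) isOpen_Ioo
      isPreconnected_Ioo (fun n s _ => picardTerm_succ_hasDerivAt hB x₀ n s)
      (fun n s hs => by
        have hs' : |s| ≤ |t| + 1 := (abs_lt.2 hs).le
        refine ((B s).le_opNorm _).trans (mul_le_mul (hC s hs') ?_ (norm_nonneg _) hC0)
        refine (norm_picardTerm_le x₀ hC0 hC n s hs').trans ?_
        gcongr)
      (by constructor <;> linarith [abs_nonneg t])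
      ((summable_nat_add_iff 1).2 (hsum 0))
      (abs_lt.1 (by linarith [abs_nonneg t]))
    have h2 := h.const_add x₀
    have h3 : B t (x₀ + ∑' n, picardTerm B x₀ (n + 1) t) =
        ∑' n, B t (picardTerm B x₀ n t) := by
      rw [← ContinuousLinearMap.map_tsum _ (hsum t), (hsum t).tsum_eq_zero_add]
      rfl
    rw [h3]
    exact h2

/-- Uniqueness for linear equations with continuous coefficients. -/
theorem linear_solution_unique {E : Type*} [NormedAddCommGroup E] [NormedSpace ℝ E]
    {B : ℝ → E →L[ℝ] E} (hB : Continuous B) {f g : ℝ → E}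
    (hf : ∀ t, HasDerivAt f (B t (f t)) t) (hg : ∀ t, HasDerivAt g (B t (g t)) t)
    (h0 : f 0 = g 0) : f = g := by
  funext t
  obtain ⟨C, hC0, hC⟩ := exists_norm_bound hB (|t| + 1)
  refine ODE_solution_unique_of_mem_Ioo (v := fun s x => B s x) (s := fun _ => Set.univ)
    (K := C.toNNReal) (t₀ := 0) (a := -(|t| + 1)) (b := |t| + 1) (fun s hs => ?_)
    (by constructor <;> linarith [abs_nonneg t]) (fun s _ => ⟨hf s, trivial⟩)
    (fun s _ => ⟨hg s, trivial⟩) h0 (abs_lt.1 (by linarith [abs_nonneg t]))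
  refine ((B s).lipschitz.weaken ?_).lipschitzOnWith
  rw [← NNReal.coe_le_coe, Real.coe_toNNReal _ hC0]
  exact hC s (abs_lt.2 hs).le

/-- The coefficient matrix acting on column vectors. -/
def zsMap (q : ℝ → ℂ) (z : ℂ) (x : ℝ) : (Fin 2 → ℂ) →L[ℝ] (Fin 2 → ℂ) :=
  LinearMap.toContinuousLinearMap ((Matrix.mulVecLin (zsMatrix q z x)).restrictScalars ℝ)

theorem zsMap_apply (q : ℝ → ℂ) (z : ℂ) (x : ℝ) (v : Fin 2 → ℂ) :
    zsMap q z x v = (zsMatrix q z x).mulVec v := rfl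

theorem zsMap_continuous {q : ℝ → ℂ} (hq : Continuous q) (z : ℂ) :
    Continuous (zsMap q z) := by
  rw [continuous_clm_apply]
  intro v
  refine continuous_pi fun i => ?_
  fin_cases i <;>
    simp [zsMap_apply, zsMatrix, Matrix.mulVec, dotProduct, Fin.sum_univ_two] <;> fun_prop

theorem IsFundamentalMatrix.column {q : ℝ → ℂ} {z : ℂ}
    {Φ : ℝ → Matrix (Fin 2) (Fin 2) ℂ} (h : IsFundamentalMatrix q z Φ) (j : Fin 2) (x : ℝ) :
    HasDerivAt (fun t i => Φ t i j) (zsMap q z x fun i => Φ x i j) x :=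
  hasDerivAt_pi.2 fun i => h.2 x i j

theorem exists_isFundamentalMatrix {q : ℝ → ℂ} (hq : Continuous q) (z : ℂ) :
    ∃ Φ, IsFundamentalMatrix q z Φ := by
  choose f hf0 hf using fun j : Fin 2 => exists_linear_solution (zsMap_continuous hq z)
    (fun i => (1 : Matrix (Fin 2) (Fin 2) ℂ) i j)
  refine ⟨fun x => Matrix.of fun i j => f j x i, ?_, fun x i j => ?_⟩
  · ext i j
    exact congrFun (hf0 j) i
  · exact hasDerivAt_pi.1 (hf j x) i

theorem fundamentalMatrix_spec {q : ℝ → ℂ} (hq : Continuous q) (z : ℂ) :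
    IsFundamentalMatrix q z (fundamentalMatrix q z) :=
  Classical.epsilon_spec (exists_isFundamentalMatrix hq z)

theorem IsFundamentalMatrix.eq_fundamentalMatrix {q : ℝ → ℂ} (hq : Continuous q) {z : ℂ}
    {Φ : ℝ → Matrix (Fin 2) (Fin 2) ℂ} (h : IsFundamentalMatrix q z Φ) :
    Φ = fundamentalMatrix q z := by
  have h' := fundamentalMatrix_spec hq z
  funext x
  ext i j
  have := linear_solution_unique (zsMap_continuous hq z) (h.column j) (h'.column j)
    (by rw [h.1, h'.1])
  exact congrFun (congrFun this x) i

/-! ### The potential `A dn(x; m)` and its Floquet discriminant -/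

/-- The potential `q(x; A, m) = A dn(x; m)`. -/
def dnPotential (A m : ℝ) (x : ℝ) : ℂ := ((A * jacobiDn x m : ℝ) : ℂ)

theorem dnPotential_continuous (A : ℝ) {m : ℝ} (hm : m ∈ Set.Ico (0 : ℝ) 1) :
    Continuous (dnPotential A m) :=
  Complex.continuous_ofReal.comp (continuous_const.mul (jacobiDn_continuous hm))

/-- The monodromy matrix `M(z; m) = Φ(2K(m); z, m)` over the period `2K(m)`. -/
def monodromy (A m : ℝ) (z : ℂ) : Matrix (Fin 2) (Fin 2) ℂ :=
  fundamentalMatrix (dnPotential A m) z (2 * ellipticK m)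

/-- The Floquet discriminant `Δ(z; m) = ½ tr M(z; m)`. -/
def discriminant (A m : ℝ) (z : ℂ) : ℂ := (monodromy A m z).trace / 2

/-- The coefficient `c(z; m)` of `σ₃` in `M = Δ 1 + c σ₃ - i s σ₂`. -/
def cCoeff (A m : ℝ) (z : ℂ) : ℂ := (monodromy A m z 0 0 - monodromy A m z 1 1) / 2

/-- The second derivative `Δ_zz(0; m)` with respect to `z` at `z = 0`. -/
def discriminantZZ (A m : ℝ) : ℂ := iteratedDeriv 2 (discriminant A m) 0

/-- The integral `(-1)^A ∫₀^π cos(2Ay) / √(1 - m sin² y) dy`. -/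
def c0Integral (A : ℕ) (m : ℝ) : ℝ :=
  (-1) ^ A * ∫ y in (0 : ℝ)..Real.pi,
    Real.cos (2 * A * y) / Real.sqrt (1 - m * Real.sin y ^ 2)

end ZSDn

end

/-! At `z = 0` the system is a pure rotation: since `am' = dn`, its solution is the rotation `R(θ)`
with `θ = A am(x; m)`. Writing `Φ = R(θ) Ψ` removes the potential and leaves `Ψ' = z N(θ) Ψ`, where
`N(θ)` is `-i` times the reflection with entries `cos 2θ`, `sin 2θ`. The right side is proportional
to `z`, so the Peano-Baker series of `Ψ` is its power series in `z`; it converges everywhere, which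
makes the discriminant entire. As `am(2K) = π`, the rotation over one period is `(-1)^A`, so `M =
(-1)^A Ψ(2K)`.

Let `C` and `S` be the integrals of `cos 2θ` and `sin 2θ` over the period. The linear term of
`Ψ(2K)` is traceless, and its `σ₃` coefficient is `-i C`. The diagonal of the quadratic term is
`-(C² + S²)/2`, because its integrand is an exact derivative. The substitution `y = am(x)` gives `C
= (-1)^A c₀(m)`, and the reflection `y ↦ π - y` gives `S = 0`. Hence `(-1)^A Δ = 1 - c₀² z²/2 +
...`, so `(-1)^A Δ_zz(0) = -c₀²`.

It remains that `c₀` increases strictly from `c₀(0) = 0`. Since `(-1)^A cos 2Ay = cos 2A(y - π/2)`,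
expanding `(1 - m sin² y)^(-1/2)` gives a power series in `m` with nonnegative coefficients; its
constant term vanishes and its coefficient of `m^A` is positive. -/

section

open Real intervalIntegral Set
-- Positivity and monotonicity of `c₀` through Fourier moments
/-- The moments `∫₀^π cos(2k(y - π/2)) sin^{2n} y dy`. -/
noncomputable def cosSinMoment (k : ℤ) (n : ℕ) : ℝ :=
  ∫ y in (0 : ℝ)..π, cos (2 * k * (y - π / 2)) * sin y ^ (2 * n)

/-- Write `sin² y = (1 + cos 2(y - π/2))/2` and use the product-to-sum formula. Centring the cosine
at `π/2` makes every weight positive, so nonnegativity propagates in `n`. -/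
theorem cosSinMoment_succ (k : ℤ) (n : ℕ) :
    cosSinMoment k (n + 1) =
      cosSinMoment k n / 2 + (cosSinMoment (k + 1) n + cosSinMoment (k - 1) n) / 4 := by
  unfold cosSinMoment
  rw [← integral_add (Continuous.intervalIntegrable (by fun_prop) _ _)
      (Continuous.intervalIntegrable (by fun_prop) _ _), ← integral_div, ← integral_div,
    ← integral_add (Continuous.intervalIntegrable (by fun_prop) _ _)
      (Continuous.intervalIntegrable (by fun_prop) _ _)]
  refine integral_congr fun y _ => ?_
  have h1 : sin y ^ 2 = (1 + cos (2 * (y - π / 2))) / 2 := by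
    rw [show 2 * (y - π / 2) = 2 * y - π by ring, cos_sub_pi, cos_two_mul, sin_sq]; ring
  have h2 : cos (2 * (k + 1 : ℤ) * (y - π / 2)) =
      cos (2 * k * (y - π / 2)) * cos (2 * (y - π / 2))
        - sin (2 * k * (y - π / 2)) * sin (2 * (y - π / 2)) := by
    rw [← cos_add]; push_cast; ring_nf
  have h3 : cos (2 * (k - 1 : ℤ) * (y - π / 2)) =
      cos (2 * k * (y - π / 2)) * cos (2 * (y - π / 2))
        + sin (2 * k * (y - π / 2)) * sin (2 * (y - π / 2)) := by
    rw [← cos_sub]; push_cast; ring_nf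
  simp only [h2, h3]
  rw [show 2 * (n + 1) = 2 * n + 2 by ring, pow_add, h1]
  ring

theorem cosSinMoment_zero_zero : cosSinMoment 0 0 = π := by
  simp [cosSinMoment]

theorem cosSinMoment_zero_right {k : ℤ} (hk : k ≠ 0) : cosSinMoment k 0 = 0 := by
  have hk' : (2 * k : ℝ) ≠ 0 := by simpa using hk
  have h : ∀ y ∈ uIcc 0 π,
      HasDerivAt (fun y => sin (2 * k * (y - π / 2)) / (2 * k))
        (cos (2 * k * (y - π / 2)) * sin y ^ (2 * 0)) y := by
    intro y _
    have := (((((hasDerivAt_id y).sub_const (π / 2)).const_mul (2 * k : ℝ)).sin).div_const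
      (2 * k : ℝ))
    refine this.congr_deriv ?_
    simp only [id, mul_one, mul_zero, pow_zero]
    field_simp
  rw [cosSinMoment, integral_eq_sub_of_hasDerivAt h
    (Continuous.intervalIntegrable (by fun_prop) _ _)]
  rw [show (2 * k * (π - π / 2) : ℝ) = k * π by ring,
    show (2 * k * (0 - π / 2) : ℝ) = -(k * π) by ring]
  simp [sin_int_mul_pi]

theorem cosSinMoment_nonneg (k : ℤ) (n : ℕ) : 0 ≤ cosSinMoment k n := by
  induction n generalizing k with
  | zero =>
    by_cases hk : k = 0
    · rw [hk, cosSinMoment_zero_zero]; exact pi_pos.le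
    · rw [cosSinMoment_zero_right hk]
  | succ n ih =>
    rw [cosSinMoment_succ]
    linarith [ih k, ih (k + 1), ih (k - 1)]

/-- In the recursion the lower neighbour of frequency `n + 1` is the previous diagonal moment, which
is positive; the other two terms are nonnegative. -/
theorem cosSinMoment_self_pos (n : ℕ) : 0 < cosSinMoment n n := by
  induction n with
  | zero => simpa [cosSinMoment_zero_zero] using pi_pos
  | succ n ih =>
    rw [cosSinMoment_succ]
    push_cast
    rw [add_sub_cancel_right]
    linarith [cosSinMoment_nonneg (n + 1) n, cosSinMoment_nonneg (n + 1 + 1) n]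

/-- These are the coefficients of `(1 - x)^(-1/2)`: the rising factorial of `1/2` divided by `n!`.
-/
theorem choose_half_pos (n : ℕ) : 0 < Ring.choose ((1 / 2 : ℝ) + n - 1) n := by
  have h := Ring.factorial_nsmul_multichoose_eq_ascPochhammer (1 / 2 : ℝ) n
  rw [Polynomial.ascPochhammer_smeval_eq_eval, nsmul_eq_mul] at h
  have hp := ascPochhammer_pos n (1 / 2 : ℝ) (by norm_num)
  rw [Ring.choose, show (1 / 2 : ℝ) + n - 1 - n + 1 = 1 / 2 by ring]
  rw [← h] at hp
  exact pos_of_mul_pos_right hp (by positivity)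

theorem hasSum_one_div_sqrt_one_sub {x : ℝ} (hx : |x| < 1) :
    HasSum (fun n : ℕ => Ring.choose ((1 / 2 : ℝ) + n - 1) n * x ^ n) (1 / sqrt (1 - x)) := by
  have h := (Real.one_div_one_sub_rpow_hasFPowerSeriesOnBall_zero (1 / 2)).hasSum (y := x)
    (by simpa [enorm_eq_nnnorm, ← NNReal.coe_lt_coe] using hx)
  simpa [FormalMultilinearSeries.ofScalars_apply_eq, sqrt_eq_rpow, mul_comm] using h

/-- Termwise integration of the binomial series. Since `sin² y ≤ 1`, the majorant is the same series
evaluated at `m`, constant in `y` and summable for `m < 1`. -/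
theorem ZSDn.hasSum_c0Integral (A : ℕ) {m : ℝ} (hm : m ∈ Ico (0 : ℝ) 1) :
    HasSum (fun n : ℕ => Ring.choose ((1 / 2 : ℝ) + n - 1) n * cosSinMoment A n * m ^ n)
      (c0Integral A m) := by
  have hm1 : |m| < 1 := by rw [abs_of_nonneg hm.1]; exact hm.2
  have h := intervalIntegral.hasSum_integral_of_dominated_convergence (a := 0) (b := π)
    (μ := MeasureTheory.volume)
    (F := fun (n : ℕ) y => Ring.choose ((1 / 2 : ℝ) + n - 1) n * (m * sin y ^ 2) ^ n *
      cos (2 * (A : ℤ) * (y - π / 2)))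
    (f := fun y => 1 / sqrt (1 - m * sin y ^ 2) * cos (2 * (A : ℤ) * (y - π / 2)))
    (fun n _ => Ring.choose ((1 / 2 : ℝ) + n - 1) n * m ^ n)
    (fun n => (Continuous.aestronglyMeasurable (by fun_prop)))
    (fun n => .of_forall fun y _ => by
      rw [norm_mul, norm_mul, norm_eq_abs, norm_eq_abs, norm_eq_abs,
        abs_of_pos (choose_half_pos n), abs_of_nonneg (pow_nonneg (mul_nonneg hm.1 (sq_nonneg _)) _)]
      calc _ ≤ Ring.choose ((1 / 2 : ℝ) + n - 1) n * m ^ n * 1 := by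
            gcongr
            · exact mul_nonneg (choose_half_pos n).le (pow_nonneg hm.1 _)
            · exact (choose_half_pos n).le
            · exact mul_nonneg hm.1 (sq_nonneg _)
            · exact mul_le_of_le_one_right hm.1 (sin_sq_le_one y)
            · exact abs_cos_le_one _
        _ = _ := mul_one _)
    (.of_forall fun y _ => (hasSum_one_div_sqrt_one_sub hm1).summable)
    (continuous_const.intervalIntegrable _ _)
    (.of_forall fun y _ => by
      refine (hasSum_one_div_sqrt_one_sub ?_).mul_right _
      rw [abs_of_nonneg (mul_nonneg hm.1 (sq_nonneg _))]
      linarith [one_sub_pos hm y])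
  have e1 : (fun n : ℕ => Ring.choose ((1 / 2 : ℝ) + n - 1) n * cosSinMoment A n * m ^ n) =
      fun n : ℕ => ∫ y in (0 : ℝ)..π, Ring.choose ((1 / 2 : ℝ) + n - 1) n * (m * sin y ^ 2) ^ n *
        cos (2 * (A : ℤ) * (y - π / 2)) := by
    funext n
    rw [cosSinMoment, ← integral_const_mul, ← integral_mul_const]
    refine integral_congr fun y _ => ?_
    simp only [mul_pow, ← pow_mul]
    ring
  have e2 : c0Integral A m =
      ∫ y in (0 : ℝ)..π, 1 / sqrt (1 - m * sin y ^ 2) * cos (2 * (A : ℤ) * (y - π / 2)) := by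
    rw [c0Integral, ← integral_const_mul]
    refine integral_congr fun y _ => ?_
    have : cos (2 * ((A : ℤ) : ℝ) * (y - π / 2)) = (-1) ^ A * cos (2 * A * y) := by
      rw [show 2 * ((A : ℤ) : ℝ) * (y - π / 2) = 2 * A * y - A * π by push_cast; ring,
        cos_sub_nat_mul_pi]
    simp only [this]
    ring
  rw [e1, e2]
  exact h

theorem ZSDn.c0Integral_zero_right {A : ℕ} (hA : 0 < A) : c0Integral A 0 = 0 := by
  refine (hasSum_c0Integral A (m := 0) (by simp)).unique ?_
  convert hasSum_zero with n
  rcases n with _ | n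
  · rw [cosSinMoment_zero_right (by exact_mod_cast hA.ne')]; simp
  · simp

theorem ZSDn.c0Integral_strictMonoOn {A : ℕ} (hA : 0 < A) :
    StrictMonoOn (c0Integral A) (Ico 0 1) := by
  intro m hm m' hm' hlt
  have hcoef : ∀ n : ℕ, 0 ≤ Ring.choose ((1 / 2 : ℝ) + n - 1) n * cosSinMoment A n :=
    fun n => mul_nonneg (choose_half_pos n).le (cosSinMoment_nonneg _ _)
  -- Strictness comes from the single term `n = A`, whose moment is known to be positive.
  refine hasSum_lt (i := A) (fun n => ?_) ?_ (hasSum_c0Integral A hm) (hasSum_c0Integral A hm')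
  · exact mul_le_mul_of_nonneg_left (pow_le_pow_left₀ hm.1 hlt.le n) (hcoef n)
  · exact mul_lt_mul_of_pos_left (pow_lt_pow_left₀ hlt hm.1 hA.ne')
      (mul_pos (choose_half_pos A) (cosSinMoment_self_pos A))

end

/-! ### The amplitude as a change of variable over one period -/

section

open Real intervalIntegral Set
namespace ZSDn

theorem jacobiAm_ellipticF {m : ℝ} (hm : m ∈ Ico (0 : ℝ) 1) (φ : ℝ) :
    jacobiAm (ellipticF m φ) m = φ :=
  (ellipticF_strictMono hm).injective (ellipticF_jacobiAm hm _)

theorem jacobiAm_zero {m : ℝ} (hm : m ∈ Ico (0 : ℝ) 1) : jacobiAm 0 m = 0 := by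
  simpa [ellipticF_zero] using jacobiAm_ellipticF hm 0

theorem hasDerivAt_jacobiAm {m : ℝ} (hm : m ∈ Ico (0 : ℝ) 1) (x : ℝ) :
    HasDerivAt (fun x => jacobiAm x m) (jacobiDn x m) x := by
  have h := HasDerivAt.of_local_left_inverse (jacobiAm_continuous hm).continuousAt
    (ellipticF_hasDerivAt hm (jacobiAm x m))
    (one_pos.trans_le (one_le_ellipticIntegrand hm _)).ne'
    (.of_forall (ellipticF_jacobiAm hm))
  simpa [ellipticIntegrand, jacobiDn] using h

theorem ellipticF_pi {m : ℝ} (hm : m ∈ Ico (0 : ℝ) 1) : ellipticF m π = 2 * ellipticK m := by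
  have hc := ellipticIntegrand_continuous hm
  have h : ∫ θ in (π / 2)..π, ellipticIntegrand m θ = ellipticK m := by
    have := integral_comp_sub_left (a := 0) (b := π / 2) (ellipticIntegrand m) π
    rw [show π - π / 2 = π / 2 by ring, sub_zero] at this
    rw [← this, ellipticK, ellipticF]
    simp [ellipticIntegrand]
  rw [ellipticF, ← integral_add_adjacent_intervals (hc.intervalIntegrable 0 (π / 2))
    (hc.intervalIntegrable _ _), h, ellipticK, ellipticF]
  ring

theorem jacobiAm_two_mul_ellipticK {m : ℝ} (hm : m ∈ Ico (0 : ℝ) 1) :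
    jacobiAm (2 * ellipticK m) m = π := by
  rw [← ellipticF_pi hm, jacobiAm_ellipticF hm]

theorem integral_comp_jacobiAm {m : ℝ} (hm : m ∈ Ico (0 : ℝ) 1) {g : ℝ → ℝ} (hg : Continuous g) :
    ∫ x in (0 : ℝ)..(2 * ellipticK m), g (jacobiAm x m) =
      ∫ y in (0 : ℝ)..π, g y * ellipticIntegrand m y := by
  have h := integral_comp_mul_deriv (a := 0) (b := π) (f := ellipticF m)
    (g := fun x => g (jacobiAm x m)) (fun x _ => ellipticF_hasDerivAt hm x)
    (ellipticIntegrand_continuous hm).continuousOn (hg.comp (jacobiAm_continuous hm))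
  simpa [ellipticF_zero, ellipticF_pi hm, jacobiAm_ellipticF hm] using h.symm

theorem integral_cos_jacobiAm (A : ℕ) {m : ℝ} (hm : m ∈ Ico (0 : ℝ) 1) :
    ∫ x in (0 : ℝ)..(2 * ellipticK m), cos (2 * A * jacobiAm x m) = (-1) ^ A * c0Integral A m := by
  rw [integral_comp_jacobiAm hm (g := fun y => cos (2 * A * y)) (by fun_prop), c0Integral,
    ← mul_assoc, ← mul_pow]
  simp [ellipticIntegrand, div_eq_mul_inv]

/-- After the substitution `y = am(x)` the integrand is odd under `y ↦ π - y`. -/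
theorem integral_sin_jacobiAm (A : ℕ) {m : ℝ} (hm : m ∈ Ico (0 : ℝ) 1) :
    ∫ x in (0 : ℝ)..(2 * ellipticK m), sin (2 * A * jacobiAm x m) = 0 := by
  rw [integral_comp_jacobiAm hm (g := fun y => sin (2 * A * y)) (by fun_prop)]
  have h := integral_comp_sub_left (a := 0) (b := π)
    (fun y => sin (2 * A * y) * ellipticIntegrand m y) π
  have h2 : ∀ y, sin (2 * A * (π - y)) * ellipticIntegrand m (π - y) =
      -(sin (2 * A * y) * ellipticIntegrand m y) := by
    intro y
    rw [show 2 * A * (π - y) = A * (2 * π) - 2 * A * y by ring, sin_nat_mul_two_pi_sub]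
    simp [ellipticIntegrand]
  simp only [h2, integral_neg, sub_self, sub_zero] at h
  linarith

end ZSDn

end

/-! ### Power series in `z` and the Peano-Baker series -/

section

open Set Filter Topology
theorem hasFPowerSeriesOnBall_of_hasSum {f : ℂ → ℂ} {a : ℕ → ℂ}
    (h : ∀ z, HasSum (fun n => a n * z ^ n) (f z)) :
    HasFPowerSeriesOnBall f (FormalMultilinearSeries.ofScalars ℂ a) 0 ⊤ := by
  have hr : (FormalMultilinearSeries.ofScalars ℂ a).radius = ⊤ := by
    refine FormalMultilinearSeries.radius_eq_top_of_summable_norm _ fun r => ?_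
    simpa [FormalMultilinearSeries.ofScalars_norm] using (h (r : ℂ)).summable.norm
  refine ⟨hr.ge, by simp, fun {z} _ => ?_⟩
  simpa [FormalMultilinearSeries.ofScalars_apply_eq, mul_comm] using h z

theorem differentiable_of_hasSum {f : ℂ → ℂ} {a : ℕ → ℂ}
    (h : ∀ z, HasSum (fun n => a n * z ^ n) (f z)) : Differentiable ℂ f := fun z =>
  ((hasFPowerSeriesOnBall_of_hasSum h).analyticAt_of_mem (by simp)).differentiableAt

theorem hasDerivAt_zero_of_hasSum {f : ℂ → ℂ} {a : ℕ → ℂ}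
    (h : ∀ z, HasSum (fun n => a n * z ^ n) (f z)) : HasDerivAt f (a 1) 0 := by
  simpa [FormalMultilinearSeries.ofScalars_apply_eq] using
    (hasFPowerSeriesOnBall_of_hasSum h).hasFPowerSeriesAt.hasDerivAt

theorem apply_zero_of_hasSum {f : ℂ → ℂ} {a : ℕ → ℂ}
    (h : ∀ z, HasSum (fun n => a n * z ^ n) (f z)) : f 0 = a 0 := by
  refine (h 0).unique ?_
  simpa using hasSum_single (f := fun n => a n * (0 : ℂ) ^ n) 0 fun n hn => by simp [hn]

theorem iteratedDeriv_two_zero_of_hasSum {f : ℂ → ℂ} {a : ℕ → ℂ}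
    (h : ∀ z, HasSum (fun n => a n * z ^ n) (f z)) : iteratedDeriv 2 f 0 = 2 * a 2 := by
  have := (hasFPowerSeriesOnBall_of_hasSum h).factorial_smul 1 2
  rw [iteratedDeriv_eq_iteratedFDeriv]
  rw [← this]
  simp

/-- The remainder of order two of an everywhere convergent power series. -/
theorem exists_second_order_remainder {f : ℂ → ℂ} {a : ℕ → ℂ}
    (h : ∀ z, HasSum (fun n => a n * z ^ n) (f z)) :
    ∃ g : ℂ → ℂ, Continuous g ∧ g 0 = a 2 ∧ ∀ z, f z = a 0 + a 1 * z + z ^ 2 * g z := by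
  have hs : ∀ z : ℂ, Summable fun n => a (n + 2) * z ^ n := by
    intro z
    by_cases hz : z = 0
    -- At `z = 0` division by `z ^ 2` is unavailable, but only the term `n = 0` survives.
    · refine summable_of_ne_finset_zero (s := {0}) fun n hn => ?_
      simp_all
    · refine (((summable_nat_add_iff 2).2 (h z).summable).mul_right ((z ^ 2)⁻¹)).congr fun n => ?_
      field_simp
      ring
  have hg : ∀ z, HasSum (fun n => a (n + 2) * z ^ n) (∑' n, a (n + 2) * z ^ n) :=
    fun z => (hs z).hasSum
  refine ⟨fun z => ∑' n, a (n + 2) * z ^ n, (differentiable_of_hasSum hg).continuous,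
    apply_zero_of_hasSum hg, fun z => ?_⟩
  rw [← (h z).tsum_eq, ← (h z).summable.sum_add_tsum_nat_add 2, ← tsum_mul_left]
  simp only [Finset.sum_range_succ, Finset.sum_range_zero, zero_add, pow_zero, mul_one, pow_one]
  congr 2
  funext n
  ring

namespace ZSDn

/-- The Peano-Baker series solves the linear equation. -/
theorem hasDerivAt_tsum_picardTerm {E : Type*} [NormedAddCommGroup E] [NormedSpace ℝ E]
    [CompleteSpace E] {B : ℝ → E →L[ℝ] E} (hB : Continuous B) (x₀ : E) :
    (∀ t, Summable fun n => picardTerm B x₀ n t) ∧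
    ∀ t, HasDerivAt (fun t => ∑' n, picardTerm B x₀ n t) (B t (∑' n, picardTerm B x₀ n t)) t := by
  have hsum : ∀ t, Summable fun n => picardTerm B x₀ n t := by
    intro t
    obtain ⟨C, hC0, hC⟩ := exists_norm_bound hB |t|
    exact Summable.of_norm_bounded (summable_bound ‖x₀‖ (C * |t|)) fun n =>
      norm_picardTerm_le x₀ hC0 hC n t le_rfl
  refine ⟨hsum, fun t => ?_⟩
  obtain ⟨C, hC0, hC⟩ := exists_norm_bound hB (|t| + 1)
  have h := hasDerivAt_tsum_of_isPreconnected (𝕜 := ℝ)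
    (g := fun n => picardTerm B x₀ (n + 1))
    (g' := fun n s => B s (picardTerm B x₀ n s))
    (u := fun n => C * (‖x₀‖ * (C * (|t| + 1)) ^ n / n.factorial))
    (t := Set.Ioo (-(|t| + 1)) (|t| + 1)) (y₀ := 0) (y := t)
    ((summable_bound ‖x₀‖ (C * (|t| + 1))).mul_left C) isOpen_Ioo
    isPreconnected_Ioo (fun n s _ => picardTerm_succ_hasDerivAt hB x₀ n s)
    (fun n s hs => by
      have hs' : |s| ≤ |t| + 1 := (abs_lt.2 hs).le
      refine ((B s).le_opNorm _).trans (mul_le_mul (hC s hs') ?_ (norm_nonneg _) hC0)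
      refine (norm_picardTerm_le x₀ hC0 hC n s hs').trans ?_
      gcongr)
    (by constructor <;> linarith [abs_nonneg t])
    ((summable_nat_add_iff 1).2 (hsum 0))
    (abs_lt.1 (by linarith [abs_nonneg t]))
  rw [ContinuousLinearMap.map_tsum _ (hsum t)]
  have e : (fun t => ∑' n, picardTerm B x₀ n t) =
      fun t => x₀ + ∑' n, picardTerm B x₀ (n + 1) t := by
    funext t
    rw [(hsum t).tsum_eq_zero_add]
    rfl
  rw [e]
  exact h.const_add x₀

/-- Each iterated integration contributes one factor `z`. This turns the Peano-Baker series into a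
power series in `z`, with coefficients independent of `z`. -/
theorem picardTerm_smul {E : Type*} [NormedAddCommGroup E] [NormedSpace ℂ E]
    {B : ℝ → E →L[ℂ] E} (x₀ : E) (z : ℂ) (n : ℕ) (t : ℝ) :
    picardTerm (fun s => (z • B s).restrictScalars ℝ) x₀ n t =
      z ^ n • picardTerm (fun s => (B s).restrictScalars ℝ) x₀ n t := by
  induction n generalizing t with
  | zero => simp [picardTerm]
  | succ n ih =>
    simp only [picardTerm, ih, ContinuousLinearMap.coe_restrictScalars']
    rw [← intervalIntegral.integral_smul]
    simp [smul_smul, pow_succ, mul_comm]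

end ZSDn

end

/-! ### The Dirac equation in the rotating frame -/

section

open Set Filter Topology
namespace ZSDn

/-- The matrix `-i R(2θ)` of the Dirac equation in the frame rotated by the angle `θ`. -/
noncomputable def rotatedMatrix (θ : ℝ) : Matrix (Fin 2) (Fin 2) ℂ :=
  !![-Complex.I * (Real.cos (2 * θ) : ℂ), -Complex.I * (Real.sin (2 * θ) : ℂ);
    -Complex.I * (Real.sin (2 * θ) : ℂ), Complex.I * (Real.cos (2 * θ) : ℂ)]

/-- The matrix `-i R(2θ)` acting on column vectors. -/
noncomputable def rotatedMap (θ : ℝ) : (Fin 2 → ℂ) →L[ℂ] (Fin 2 → ℂ) :=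
  LinearMap.toContinuousLinearMap (Matrix.mulVecLin (rotatedMatrix θ))

theorem rotatedMap_apply (θ : ℝ) (v : Fin 2 → ℂ) :
    rotatedMap θ v = ![-Complex.I * (Real.cos (2 * θ) * v 0 + Real.sin (2 * θ) * v 1),
      -Complex.I * (Real.sin (2 * θ) * v 0 - Real.cos (2 * θ) * v 1)] := by
  ext i
  fin_cases i <;>
    simp [rotatedMap, rotatedMatrix, Matrix.mulVec, dotProduct, Fin.sum_univ_two] <;> ring

theorem continuous_smul_rotatedMap {θ : ℝ → ℝ} (hθ : Continuous θ) (z : ℂ) :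
    Continuous fun s => (z • rotatedMap (θ s)).restrictScalars ℝ := by
  rw [continuous_clm_apply]
  intro v
  refine continuous_pi fun i => ?_
  fin_cases i <;> simp [rotatedMap_apply] <;> fun_prop

/-- The coefficient of `z ^ n` in the solution, with initial value `v`, of the Dirac equation in
the frame rotated by `θ`. -/
noncomputable def rotatedTerm (θ : ℝ → ℝ) (v : Fin 2 → ℂ) (n : ℕ) (t : ℝ) : Fin 2 → ℂ :=
  picardTerm (fun s => (rotatedMap (θ s)).restrictScalars ℝ) v n t

theorem hasSum_rotatedTerm {θ : ℝ → ℝ} (hθ : Continuous θ) (v : Fin 2 → ℂ) (z : ℂ) (t : ℝ) :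
    HasSum (fun n => z ^ n • rotatedTerm θ v n t) (∑' n, z ^ n • rotatedTerm θ v n t) := by
  refine Summable.hasSum ?_
  have h := (hasDerivAt_tsum_picardTerm (continuous_smul_rotatedMap hθ z) v).1 t
  simp only [picardTerm_smul] at h
  exact h

theorem hasDerivAt_tsum_rotatedTerm {θ : ℝ → ℝ} (hθ : Continuous θ) (v : Fin 2 → ℂ) (z : ℂ)
    (t : ℝ) :
    HasDerivAt (fun t => ∑' n, z ^ n • rotatedTerm θ v n t)
      (z • rotatedMap (θ t) (∑' n, z ^ n • rotatedTerm θ v n t)) t := by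
  have h := (hasDerivAt_tsum_picardTerm (continuous_smul_rotatedMap hθ z) v).2 t
  simp only [picardTerm_smul] at h
  exact h

theorem rotatedTerm_zero_right (θ : ℝ → ℝ) (v : Fin 2 → ℂ) (n : ℕ) :
    rotatedTerm θ v (n + 1) 0 = 0 := by
  simp [rotatedTerm, picardTerm]

/-- Lets a coefficient be computed by guessing an antiderivative that vanishes at `0`, one component
at a time. -/
theorem rotatedTerm_succ_apply_eq {θ : ℝ → ℝ} (hθ : Continuous θ) (v : Fin 2 → ℂ) (n : ℕ)
    (i : Fin 2) {F : ℝ → ℂ} (hF0 : F 0 = 0)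
    (hF : ∀ t, HasDerivAt F (rotatedMap (θ t) (rotatedTerm θ v n t) i) t) (t : ℝ) :
    rotatedTerm θ v (n + 1) t i = F t := by
  have hB : Continuous fun s => (rotatedMap (θ s)).restrictScalars ℝ := by
    simpa using continuous_smul_rotatedMap hθ 1
  have hd : ∀ t, HasDerivAt (fun t => rotatedTerm θ v (n + 1) t i - F t) 0 t := fun t =>
    (((hasDerivAt_pi.1 (picardTerm_succ_hasDerivAt hB v n t)) i).sub (hF t)).congr_deriv
      (sub_self _)
  have := is_const_of_deriv_eq_zero (fun t => (hd t).differentiableAt) (fun t => (hd t).deriv) t 0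
  simpa [rotatedTerm_zero_right, hF0, sub_eq_zero] using this

/-- Differentiating the rotation reproduces the potential `p = θ'`. The rest is the intertwining of
`-i σ₃` with the rotated matrix by `R(θ)`. -/
theorem isFundamentalMatrix_rotated {θ p : ℝ → ℝ} (hθ : ∀ x, HasDerivAt θ (p x) x)
    (hθ0 : θ 0 = 0) (z : ℂ) :
    IsFundamentalMatrix (fun x => (p x : ℂ)) z fun x =>
      !![(Real.cos (θ x) : ℂ), Real.sin (θ x); -Real.sin (θ x), Real.cos (θ x)] *
        Matrix.of fun i j => (∑' n, z ^ n • rotatedTerm θ (Pi.single j 1) n x) i := by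
  have hc : Continuous θ := continuous_iff_continuousAt.2 fun x => (hθ x).continuousAt
  constructor
  · have h0 : ∀ j : Fin 2, (∑' n, z ^ n • rotatedTerm θ (Pi.single j 1) n 0) = Pi.single j 1 := by
      intro j
      rw [tsum_eq_single 0]
      · simp [rotatedTerm, picardTerm]
      · rintro (_ | n) hn
        · exact absurd rfl hn
        · simp [rotatedTerm_zero_right]
    ext i j
    simp only [h0, hθ0]
    fin_cases i <;> fin_cases j <;> simp [Matrix.mul_apply]
  · intro x i j
    have hΨ := hasDerivAt_tsum_rotatedTerm hc (Pi.single j 1) z x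
    set Ψ : ℝ → Fin 2 → ℂ := fun t => ∑' n, z ^ n • rotatedTerm θ (Pi.single j 1) n t with hΨdef
    have hu := hasDerivAt_pi.1 hΨ 0
    have hv := hasDerivAt_pi.1 hΨ 1
    have hcos := ((Real.hasDerivAt_cos (θ x)).comp x (hθ x)).ofReal_comp
    have hsin := ((Real.hasDerivAt_sin (θ x)).comp x (hθ x)).ofReal_comp
    -- The intertwining amounts to the subtraction formulas for `θ = 2θ - θ`.
    have key1 : (Real.cos (θ x) : ℂ) = Real.cos (2 * θ x) * Real.cos (θ x)
        + Real.sin (2 * θ x) * Real.sin (θ x) := by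
      rw [← Complex.ofReal_mul, ← Complex.ofReal_mul, ← Complex.ofReal_add, ← Real.cos_sub]
      ring_nf
    have key2 : (Real.sin (θ x) : ℂ) = Real.sin (2 * θ x) * Real.cos (θ x)
        - Real.cos (2 * θ x) * Real.sin (θ x) := by
      rw [← Complex.ofReal_mul, ← Complex.ofReal_mul, ← Complex.ofReal_sub, ← Real.sin_sub]
      ring_nf
    have hΨx : (∑' n, z ^ n • rotatedTerm θ (Pi.single j 1) n x) = Ψ x := rfl
    rw [rotatedMap_apply] at hu hv
    simp only [Pi.smul_apply, smul_eq_mul, Matrix.cons_val_zero, Matrix.cons_val_one] at hu hv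
    fin_cases i
    · have h := (hcos.mul hu).add (hsin.mul hv)
      simp only [Matrix.mul_apply, Fin.sum_univ_two, zsMatrix, Matrix.of_apply]
      refine (h.congr_deriv ?_)
      simp [hΨx]
      push_cast at key1 key2
      linear_combination (Complex.I * z * Ψ x 0) * key1 + (Complex.I * z * Ψ x 1) * key2
    · have h := (hsin.neg.mul hu).add (hcos.mul hv)
      simp only [Matrix.mul_apply, Fin.sum_univ_two, zsMatrix, Matrix.of_apply]
      refine (h.congr_deriv ?_)
      simp [hΨx]
      push_cast at key1 key2
      linear_combination (Complex.I * z * Ψ x 0) * key2 - (Complex.I * z * Ψ x 1) * key1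

end ZSDn

end

/-! ### Taylor coefficients of `Δ` and `c` at `z = 0` -/

section

open Set Filter Topology
namespace ZSDn

theorem hasDerivAt_integral_cos {θ : ℝ → ℝ} (hθ : Continuous θ) (t : ℝ) :
    HasDerivAt (fun t => ((∫ s in (0 : ℝ)..t, Real.cos (2 * θ s) : ℝ) : ℂ))
      (Real.cos (2 * θ t) : ℂ) t :=
  (Continuous.integral_hasStrictDerivAt (by fun_prop) 0 t).hasDerivAt.ofReal_comp

theorem hasDerivAt_integral_sin {θ : ℝ → ℝ} (hθ : Continuous θ) (t : ℝ) :
    HasDerivAt (fun t => ((∫ s in (0 : ℝ)..t, Real.sin (2 * θ s) : ℝ) : ℂ))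
      (Real.sin (2 * θ t) : ℂ) t :=
  (Continuous.integral_hasStrictDerivAt (by fun_prop) 0 t).hasDerivAt.ofReal_comp

theorem rotatedTerm_one {θ : ℝ → ℝ} (hθ : Continuous θ) (v : Fin 2 → ℂ) (t : ℝ) :
    rotatedTerm θ v 1 t =
      ![-Complex.I * ((∫ s in (0 : ℝ)..t, Real.cos (2 * θ s) : ℝ) * v 0
          + (∫ s in (0 : ℝ)..t, Real.sin (2 * θ s) : ℝ) * v 1),
        -Complex.I * ((∫ s in (0 : ℝ)..t, Real.sin (2 * θ s) : ℝ) * v 0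
          - (∫ s in (0 : ℝ)..t, Real.cos (2 * θ s) : ℝ) * v 1)] := by
  have hC := hasDerivAt_integral_cos hθ
  have hS := hasDerivAt_integral_sin hθ
  ext i
  refine rotatedTerm_succ_apply_eq hθ v 0 i (F := fun t => ![-Complex.I *
    ((∫ s in (0 : ℝ)..t, Real.cos (2 * θ s) : ℝ) * v 0
          + (∫ s in (0 : ℝ)..t, Real.sin (2 * θ s) : ℝ) * v 1),
        -Complex.I * ((∫ s in (0 : ℝ)..t, Real.sin (2 * θ s) : ℝ) * v 0
          - (∫ s in (0 : ℝ)..t, Real.cos (2 * θ s) : ℝ) * v 1)] i) ?_ (fun t => ?_) t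
  · fin_cases i <;> simp
  · rw [rotatedMap_apply]
    fin_cases i
    · exact (((hC t).mul_const (v 0)).add ((hS t).mul_const (v 1))).const_mul (-Complex.I)
    · exact (((hS t).mul_const (v 0)).sub ((hC t).mul_const (v 1))).const_mul (-Complex.I)

/-- With `C` and `S` the running integrals, the diagonal integrand is `-(C' C + S' S)`, an exact
derivative. The off-diagonal entries are not needed, since only diagonal entries enter the trace. -/
theorem rotatedTerm_two_diag {θ : ℝ → ℝ} (hθ : Continuous θ) (j : Fin 2) (t : ℝ) :
    rotatedTerm θ (Pi.single j 1) 2 t j =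
      -(((∫ s in (0 : ℝ)..t, Real.cos (2 * θ s) : ℝ) : ℂ) ^ 2
        + ((∫ s in (0 : ℝ)..t, Real.sin (2 * θ s) : ℝ) : ℂ) ^ 2) / 2 := by
  refine rotatedTerm_succ_apply_eq hθ _ 1 j (F := fun t =>
    -(((∫ s in (0 : ℝ)..t, Real.cos (2 * θ s) : ℝ) : ℂ) ^ 2
        + ((∫ s in (0 : ℝ)..t, Real.sin (2 * θ s) : ℝ) : ℂ) ^ 2) / 2) (by simp) (fun t => ?_) t
  have h := ((((hasDerivAt_integral_cos hθ t).pow 2).add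
    ((hasDerivAt_integral_sin hθ t).pow 2)).neg).div_const 2
  refine h.congr_deriv ?_
  rw [rotatedTerm_one hθ, rotatedMap_apply]
  have hI := Complex.I_mul_I
  fin_cases j <;> simp <;>
    linear_combination (-(Complex.cos (2 * θ t) * (∫ s in (0 : ℝ)..t, Real.cos (2 * θ s) : ℝ)
      + Complex.sin (2 * θ t) * (∫ s in (0 : ℝ)..t, Real.sin (2 * θ s) : ℝ))) * hI

/-- At `x = 2K` the angle is `Aπ`, so the rotation factor is the scalar `(-1)^A`. -/
theorem hasSum_monodromy (A : ℕ) {m : ℝ} (hm : m ∈ Ico (0 : ℝ) 1) (i j : Fin 2) (z : ℂ) :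
    HasSum (fun n => (-1) ^ A * rotatedTerm (fun x => A * jacobiAm x m) (Pi.single j 1) n
      (2 * ellipticK m) i * z ^ n) (monodromy A m z i j) := by
  have hθ : ∀ x, HasDerivAt (fun x => A * jacobiAm x m) (A * jacobiDn x m) x :=
    fun x => (hasDerivAt_jacobiAm hm x).const_mul _
  have hc : Continuous fun x => A * jacobiAm x m := continuous_const.mul (jacobiAm_continuous hm)
  have hΦ := (isFundamentalMatrix_rotated hθ (by simp [jacobiAm_zero hm]) z).eq_fundamentalMatrix
    (dnPotential_continuous A hm)
  have hM := congrFun (congrFun (congrFun hΦ (2 * ellipticK m)) i) j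
  have hs := (Pi.hasSum.1 (hasSum_rotatedTerm hc (Pi.single j 1) z (2 * ellipticK m)) i).mul_left
    ((-1 : ℂ) ^ A)
  have hval : monodromy A m z i j = (-1) ^ A *
      (∑' n, z ^ n • rotatedTerm (fun x => A * jacobiAm x m) (Pi.single j 1) n
        (2 * ellipticK m)) i := by
    refine Eq.trans hM.symm ?_
    simp only [jacobiAm_two_mul_ellipticK hm, Real.cos_nat_mul_pi, Real.sin_nat_mul_pi]
    fin_cases i <;> simp [Matrix.mul_apply]
  rw [hval]
  simpa [mul_comm, mul_left_comm] using hs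

/-- The coefficients of the power series of the discriminant. -/
noncomputable def discriminantCoeff (A : ℕ) (m : ℝ) (n : ℕ) : ℂ :=
  (-1) ^ A * ((rotatedTerm (fun x => A * jacobiAm x m) (Pi.single 0 1) n (2 * ellipticK m) 0
    + rotatedTerm (fun x => A * jacobiAm x m) (Pi.single 1 1) n (2 * ellipticK m) 1) / 2)

/-- The coefficients of the power series of `c(z; m)`. -/
noncomputable def cCoeffCoeff (A : ℕ) (m : ℝ) (n : ℕ) : ℂ :=
  (-1) ^ A * ((rotatedTerm (fun x => A * jacobiAm x m) (Pi.single 0 1) n (2 * ellipticK m) 0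
    - rotatedTerm (fun x => A * jacobiAm x m) (Pi.single 1 1) n (2 * ellipticK m) 1) / 2)

theorem hasSum_discriminant (A : ℕ) {m : ℝ} (hm : m ∈ Ico (0 : ℝ) 1) (z : ℂ) :
    HasSum (fun n => discriminantCoeff A m n * z ^ n) (discriminant A m z) := by
  rw [discriminant, Matrix.trace_fin_two]
  refine (((hasSum_monodromy A hm 0 0 z).add (hasSum_monodromy A hm 1 1 z)).div_const 2).congr_fun
    fun n => ?_
  rw [discriminantCoeff]
  ring

theorem hasSum_cCoeff (A : ℕ) {m : ℝ} (hm : m ∈ Ico (0 : ℝ) 1) (z : ℂ) :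
    HasSum (fun n => cCoeffCoeff A m n * z ^ n) (cCoeff A m z) := by
  rw [cCoeff]
  refine (((hasSum_monodromy A hm 0 0 z).sub (hasSum_monodromy A hm 1 1 z)).div_const 2).congr_fun
    fun n => ?_
  rw [cCoeffCoeff]
  ring

theorem discriminantCoeff_zero (A : ℕ) (m : ℝ) : discriminantCoeff A m 0 = (-1) ^ A := by
  simp [discriminantCoeff, rotatedTerm, picardTerm]

theorem cCoeffCoeff_zero (A : ℕ) (m : ℝ) : cCoeffCoeff A m 0 = 0 := by
  simp [cCoeffCoeff, rotatedTerm, picardTerm]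

theorem discriminantCoeff_one (A : ℕ) {m : ℝ} (hm : m ∈ Ico (0 : ℝ) 1) :
    discriminantCoeff A m 1 = 0 := by
  have hc : Continuous fun x => A * jacobiAm x m := continuous_const.mul (jacobiAm_continuous hm)
  simp [discriminantCoeff, rotatedTerm_one hc]

theorem cCoeffCoeff_one (A : ℕ) {m : ℝ} (hm : m ∈ Ico (0 : ℝ) 1) :
    cCoeffCoeff A m 1 = -Complex.I * (c0Integral A m : ℂ) := by
  have hc : Continuous fun x => A * jacobiAm x m := continuous_const.mul (jacobiAm_continuous hm)
  have h := integral_cos_jacobiAm A hm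
  simp only [mul_assoc] at h
  simp only [cCoeffCoeff, rotatedTerm_one hc, h]
  have h1 : ((-1 : ℂ) ^ A) * (-1) ^ A = 1 := by rw [← mul_pow]; simp
  simp
  linear_combination (-Complex.I * (c0Integral A m : ℂ)) * h1

theorem discriminantCoeff_two (A : ℕ) {m : ℝ} (hm : m ∈ Ico (0 : ℝ) 1) :
    discriminantCoeff A m 2 = -(-1) ^ A * (c0Integral A m : ℂ) ^ 2 / 2 := by
  have hc : Continuous fun x => A * jacobiAm x m := continuous_const.mul (jacobiAm_continuous hm)
  have h := integral_cos_jacobiAm A hm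
  have h' := integral_sin_jacobiAm A hm
  simp only [mul_assoc] at h h'
  simp only [discriminantCoeff, rotatedTerm_two_diag hc, h, h']
  have h1 : ((-1 : ℂ) ^ A) ^ 2 = 1 := by rw [← pow_mul, mul_comm, pow_mul]; simp
  push_cast
  linear_combination (-(-1) ^ A * (c0Integral A m : ℂ) ^ 2 / 2) * h1

theorem discriminantZZ_eq (A : ℕ) {m : ℝ} (hm : m ∈ Ico (0 : ℝ) 1) :
    discriminantZZ A m = ((-(-1) ^ A * c0Integral A m ^ 2 : ℝ) : ℂ) := by
  rw [discriminantZZ, iteratedDeriv_two_zero_of_hasSum (hasSum_discriminant A hm),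
    discriminantCoeff_two A hm]
  push_cast
  ring

theorem neg_one_pow_mul_discriminantZZ_re (A : ℕ) {m : ℝ} (hm : m ∈ Ico (0 : ℝ) 1) :
    (-1) ^ A * (discriminantZZ A m).re = -c0Integral A m ^ 2 := by
  rw [discriminantZZ_eq A hm, Complex.ofReal_re]
  have h1 : ((-1 : ℝ) ^ A) * (-1) ^ A = 1 := by rw [← mul_pow]; simp
  linear_combination (-c0Integral A m ^ 2) * h1

/-- For `z = iy` one has `z² = -y²`, so the negative quadratic coefficient of `(-1)^A Δ` pushes its
real part above `1`. Continuity of the remainder factor `g` keeps the sign near `0`, and the norm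
dominates the real part. -/
theorem eventually_one_lt_norm_discriminant (A : ℕ) {m : ℝ} (hm : m ∈ Ico (0 : ℝ) 1)
    (hc : c0Integral A m ≠ 0) :
    ∀ᶠ y : ℝ in 𝓝[≠] 0, 1 < ‖discriminant A m (Complex.I * (y : ℂ))‖ := by
  obtain ⟨g, hg, hg0, hfg⟩ := exists_second_order_remainder (hasSum_discriminant A hm)
  have h1 : ((-1 : ℂ) ^ A) * (-1) ^ A = 1 := by rw [← mul_pow]; simp
  have hcont : Continuous fun y : ℝ => ((-1 : ℂ) ^ A * g (Complex.I * y)).re := by fun_prop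
  have hneg : ((-1 : ℂ) ^ A * g (Complex.I * (0 : ℝ))).re < 0 := by
    have : (-1 : ℂ) ^ A * g (Complex.I * (0 : ℝ)) = ((-(c0Integral A m ^ 2 / 2) : ℝ) : ℂ) := by
      rw [Complex.ofReal_zero, mul_zero, hg0, discriminantCoeff_two A hm]
      push_cast
      linear_combination (-(c0Integral A m : ℂ) ^ 2 / 2) * h1
    rw [this, Complex.ofReal_re]
    have := pow_pos (abs_pos.2 hc) 2
    rw [sq_abs] at this
    linarith
  have hev := hcont.continuousAt.eventually_lt continuousAt_const hneg
  filter_upwards [nhdsWithin_le_nhds hev, self_mem_nhdsWithin] with y hy hy0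
  have e : (-1 : ℂ) ^ A * discriminant A m (Complex.I * y) =
      1 - ((y ^ 2 : ℝ) : ℂ) * ((-1) ^ A * g (Complex.I * y)) := by
    rw [hfg, discriminantCoeff_zero, discriminantCoeff_one A hm]
    push_cast
    linear_combination h1 + (-1 : ℂ) ^ A * y ^ 2 * g (Complex.I * y) * Complex.I_sq
  calc 1 < 1 - y ^ 2 * ((-1 : ℂ) ^ A * g (Complex.I * y)).re := by
        have : 0 < y ^ 2 := pow_pos (abs_pos.2 hy0) 2 |>.trans_eq (sq_abs y)
        nlinarith
    _ = ((-1 : ℂ) ^ A * discriminant A m (Complex.I * y)).re := by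
        rw [e, Complex.sub_re, Complex.re_ofReal_mul, Complex.one_re]
    _ ≤ ‖(-1 : ℂ) ^ A * discriminant A m (Complex.I * y)‖ := Complex.re_le_norm _
    _ = ‖discriminant A m (Complex.I * y)‖ := by simp

end ZSDn

end

/-! ### Assembly of the claims -/

theorem lemmal (A : ℕ) (hA : 0 < A) :
    -- for every `m ∈ [0,1)`, `Δ(·; m)` is entire, so that its derivatives below are genuine
    (∀ m ∈ Set.Ico (0 : ℝ) 1, Differentiable ℂ (ZSDn.discriminant A m)) ∧
    -- `Δ_zz(0; 0) = 0`
    ZSDn.discriminantZZ A 0 = 0 ∧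
    -- `(-1)^A Δ_zz(0; m)` is real, strictly decreasing on `[0,1)` and negative on `(0,1)`
    (∀ m ∈ Set.Ico (0 : ℝ) 1, (ZSDn.discriminantZZ A m).im = 0) ∧
    StrictAntiOn (fun m : ℝ => (-1) ^ A * (ZSDn.discriminantZZ A m).re) (Set.Ico 0 1) ∧
    (∀ m ∈ Set.Ioo (0 : ℝ) 1, (-1) ^ A * (ZSDn.discriminantZZ A m).re < 0) ∧
    -- `c(z; m) = -i c₀(m) z + o(z)` as `z → 0`, with `c₀(m)` the elliptic integral, `c₀(m) > 0`
    (∀ m ∈ Set.Ico (0 : ℝ) 1, ZSDn.cCoeff A m 0 = 0 ∧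
      HasDerivAt (ZSDn.cCoeff A m) (-Complex.I * (ZSDn.c0Integral A m : ℂ)) 0) ∧
    (∀ m ∈ Set.Ioo (0 : ℝ) 1, 0 < ZSDn.c0Integral A m) ∧
    -- `Δ(0; m) = (-1)^A`, `z = 0` is a simple critical point of `Δ(·; m)`, and `|Δ| > 1` on a
    -- deleted neighbourhood of `0` in the imaginary axis
    (∀ m ∈ Set.Ioo (0 : ℝ) 1,
      ZSDn.discriminant A m 0 = (-1) ^ A ∧
      deriv (ZSDn.discriminant A m) 0 = 0 ∧
      ZSDn.discriminantZZ A m ≠ 0 ∧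
      ∀ᶠ y : ℝ in nhdsWithin 0 {0}ᶜ,
        1 < ‖ZSDn.discriminant A m (Complex.I * (y : ℂ))‖) := by
  have hsub : ∀ m ∈ Set.Ioo (0 : ℝ) 1, m ∈ Set.Ico (0 : ℝ) 1 := fun m hm => ⟨hm.1.le, hm.2⟩
  have h0 : (0 : ℝ) ∈ Set.Ico (0 : ℝ) 1 := by simp
  have hpos : ∀ m ∈ Set.Ioo (0 : ℝ) 1, 0 < ZSDn.c0Integral A m := fun m hm => by
    simpa [ZSDn.c0Integral_zero_right hA] using
      ZSDn.c0Integral_strictMonoOn hA h0 (hsub m hm) hm.1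
  have hnonneg : ∀ m ∈ Set.Ico (0 : ℝ) 1, 0 ≤ ZSDn.c0Integral A m := fun m hm => by
    simpa [ZSDn.c0Integral_zero_right hA] using
      (ZSDn.c0Integral_strictMonoOn hA).monotoneOn h0 hm hm.1
  refine ⟨fun m hm => differentiable_of_hasSum (ZSDn.hasSum_discriminant A hm), ?_,
    fun m hm => ?_, fun m hm m' hm' hlt => ?_, fun m hm => ?_, fun m hm => ⟨?_, ?_⟩, hpos,
    fun m hm => ⟨?_, ?_, ?_, ?_⟩⟩
  · simp [ZSDn.discriminantZZ_eq A h0, ZSDn.c0Integral_zero_right hA]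
  · rw [ZSDn.discriminantZZ_eq A hm, Complex.ofReal_im]
  · simp only [ZSDn.neg_one_pow_mul_discriminantZZ_re A hm,
      ZSDn.neg_one_pow_mul_discriminantZZ_re A hm']
    -- Squaring preserves the strict order because `c₀ ≥ 0` on `[0,1)`.
    exact neg_lt_neg (pow_lt_pow_left₀ (ZSDn.c0Integral_strictMonoOn hA hm hm' hlt)
      (hnonneg m hm) two_ne_zero)
  · rw [ZSDn.neg_one_pow_mul_discriminantZZ_re A (hsub m hm)]
    exact neg_neg_of_pos (pow_pos (hpos m hm) 2)
  · rw [apply_zero_of_hasSum (ZSDn.hasSum_cCoeff A hm), ZSDn.cCoeffCoeff_zero]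
  · rw [← ZSDn.cCoeffCoeff_one A hm]
    exact hasDerivAt_zero_of_hasSum (ZSDn.hasSum_cCoeff A hm)
  · rw [apply_zero_of_hasSum (ZSDn.hasSum_discriminant A (hsub m hm)),
      ZSDn.discriminantCoeff_zero]
  · rw [(hasDerivAt_zero_of_hasSum (ZSDn.hasSum_discriminant A (hsub m hm))).deriv,
      ZSDn.discriminantCoeff_one A (hsub m hm)]
  · rw [ZSDn.discriminantZZ_eq A (hsub m hm), Complex.ofReal_ne_zero]
    exact mul_ne_zero (neg_ne_zero.2 (pow_ne_zero _ (by norm_num)))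
      (pow_pos (hpos m hm) 2).ne'
  · exact ZSDn.eventually_one_lt_norm_discriminant A (hsub m hm) (hpos m hm).ne'
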